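/- \textbf{Theorem (approximation theorem for C-SIPS).} Let $\mathcal X=[-M,M]^p$ with $M>0$, let $\mathcal Y\subset\mathbb R^{K^*}$ be compact, let $f_*:\mathcal X\to\mathcal Y$ be continuous, and let $g_*:\mathcal Y^2\to\mathbb R$ be a conditionally positive definite (CPD) kernel, i.e. $g_*$ is symmetric and continuous and $\sum_{i=1}^n\sum_{j=1}^n c_ic_j\,g_*(y_i,y_j)\ge 0$ for all $n$, all $y_1,\dots,y_n\in\mathcal Y$ and all $c_1,\dots,c_n\in\mathbb R$ with $\sum_{i=1}^n c_i=0$. Let $\sigma:\mathbb R\to\mathbb R$ be either the ReLU $t\mapsto\max\{0,t\}$ or a non-constant, continuous, bounded, monotonically increasing (not necessarily strictly) function, applied entrywise to vectors. Then there exist constants $C>0$, $r_0>0$ and a function $\gamma:\mathbb R\to\mathbb R$ with $|\gamma(r)|\le C r^2$ for all $r\ge r_0$ (that is, $\gamma=O(r^2)$) such that the following holds. For every $\varepsilon>0$ and every $r\ge r_0$ there is $K_0\in\mathbb N$ such that for every $K\ge K_0$ there is $m_0\in\mathbb N$ (depending on $K$) such that for every $m\ge m_0$ there are $A\in\mathbb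 R^{K\times m}$, $B\in\mathbb R^{m\times p}$, $c\in\mathbb R^m$ for which the one-hidden-layer neural network $f_{\mathrm{NN}}(x)=A\,\sigma(Bx+c)$ satisfies $$\Bigl|\,g_*\bigl(f_*(x),f_*(x')\bigr)-\bigl(\langle f_{\mathrm{NN}}(x),f_{\mathrm{NN}}(x')\rangle-\gamma(r)\bigr)\Bigr|<\varepsilon+\frac{C}{r^{2}}\qquad\text{for all }x,x'\in\mathcal X.$$ In particular, the constants $C$ and $r_0$ and the shift $\gamma(r)$ do not depend on $\varepsilon$, $K$ or $m$. -/

import Mathlib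

open scoped Matrix

/-- The cube `[-M, M]^p` in `ℝ^p`. -/
def cube (p : ℕ) (M : ℝ) : Set (EuclideanSpace ℝ (Fin p)) :=
  {x | ∀ i, x i ∈ Set.Icc (-M) M}

/-- A kernel on `Y²`: a symmetric continuous function `Y × Y → ℝ`. -/
structure IsKernel {Y : Type*} [TopologicalSpace Y] (g : Y → Y → ℝ) : Prop where
  symm : ∀ y y', g y y' = g y' y
  continuous : Continuous fun q : Y × Y => g q.1 q.2

/-- A conditionally positive definite kernel on `Y²`. -/
structure IsCPDKernel {Y : Type*} [TopologicalSpace Y] (g : Y → Y → ℝ) : Prop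
    extends IsKernel g where
  cpd : ∀ (n : ℕ) (c : Fin n → ℝ) (y : Fin n → Y), ∑ i, c i = 0 →
    0 ≤ ∑ i, ∑ j, c i * c j * g (y i) (y j)

/-- The rectified linear unit. -/
def relu (t : ℝ) : ℝ := max 0 t

/-- ReLU, or a non-constant, continuous, bounded, monotonically increasing function. -/
def IsActivation (σ : ℝ → ℝ) : Prop :=
  σ = relu ∨
    ((¬ ∃ a, ∀ t, σ t = a) ∧ Continuous σ ∧ (∃ b, ∀ t, |σ t| ≤ b) ∧ Monotone σ)

/-- The one-hidden-layer network `x ↦ A σ(B x + c)`, with `σ` applied entrywise, having `m`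
hidden units and `K` outputs. -/
noncomputable def oneHiddenNN (σ : ℝ → ℝ) {p m K : ℕ} (A : Matrix (Fin K) (Fin m) ℝ)
    (B : Matrix (Fin m) (Fin p) ℝ) (c : Fin m → ℝ) (x : EuclideanSpace ℝ (Fin p)) :
    EuclideanSpace ℝ (Fin K) :=
  WithLp.toLp 2 (A *ᵥ fun j => σ ((B *ᵥ x.ofLp) j + c j))

/-! A CPD kernel pinned at a base point `y₀` is positive semidefinite, so along `fstar` the kernel
splits as G(x, x') + h(x) + h(x') with G positive semidefinite. G is uniformly close to an inner
product of finitely many continuous features: take a Gram factorization of G on a fine net and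
interpolate it by a partition of unity (`exists_feature_map_approx`). The additive part, which need
not be positive semidefinite, is absorbed by one more feature r + h/r, since (r + h/r)(r + h'/r) =
r² + h + h' + hh'/r²: the shift is γ(r) = r² and the error is O(1/r²). Finally, networks approximate
all features at once by universal approximation (`IsActivation.dense_neuronSpan`). -/

open Filter Topology

/-! ### Positive semidefinite kernels and finite feature maps -/

open scoped MatrixOrder Matrix.Norms.L2Operator in
/-- A positive semidefinite real matrix is a Gram matrix. -/
theorem Matrix.PosSemidef.exists_eq_sum_mul {n : ℕ} {P : Matrix (Fin n) (Fin n) ℝ}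
    (hP : P.PosSemidef) :
    ∃ B : Matrix (Fin n) (Fin n) ℝ, ∀ i j, P i j = ∑ k, B k i * B k j := by
  obtain ⟨B, hB⟩ := CStarAlgebra.nonneg_iff_eq_star_mul_self.1 hP.nonneg
  refine ⟨B, fun i j => ?_⟩
  simpa [Matrix.star_eq_conjTranspose, Matrix.mul_apply] using congrFun (congrFun hB i) j

/-- Pinning a conditionally positive definite kernel at a base point gives a positive
semidefinite kernel. -/
theorem IsCPDKernel.pinned_nonneg {Y : Type*} [TopologicalSpace Y] {g : Y → Y → ℝ}
    (hg : IsCPDKernel g) (y₀ : Y) {n : ℕ} (c : Fin n → ℝ) (y : Fin n → Y) :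
    0 ≤ ∑ i, ∑ j, c i * c j * (g (y i) (y j) - g (y i) y₀ - g y₀ (y j) + g y₀ y₀) := by
  -- Giving `y₀` the weight `-∑ c` makes the total weight zero, as the CPD condition requires.
  have h := hg.cpd (n + 1) (Fin.cons (-∑ i, c i) c) (Fin.cons y₀ y) (by simp [Fin.sum_univ_succ])
  simp only [Fin.sum_univ_succ, Fin.cons_zero, Fin.cons_succ] at h
  obtain ⟨s, hs⟩ : ∃ s, s = ∑ i, c i := ⟨_, rfl⟩
  rw [← hs] at h
  convert h using 1
  simp only [mul_add, mul_sub, Finset.sum_add_distrib, Finset.sum_sub_distrib]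
  have e₁ : ∑ i, ∑ j, c i * c j * g (y i) y₀ = (∑ i, c i * g (y i) y₀) * s := by
    rw [hs, Finset.sum_mul_sum]
    exact Finset.sum_congr rfl fun i _ => Finset.sum_congr rfl fun j _ => by ring
  have e₂ : ∑ i, ∑ j, c i * c j * g y₀ (y j) = s * ∑ j, c j * g y₀ (y j) := by
    rw [hs, Finset.sum_mul_sum]
    exact Finset.sum_congr rfl fun i _ => Finset.sum_congr rfl fun j _ => by ring
  have e₃ : ∑ i, ∑ j, c i * c j * g y₀ y₀ = s * s * g y₀ y₀ := by
    rw [hs, Finset.sum_mul_sum]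
    simp only [Finset.sum_mul]
  have e₄ : ∑ i, -s * c i * g y₀ (y i) = -(s * ∑ j, c j * g y₀ (y j)) := by
    simp only [mul_assoc, ← Finset.mul_sum, neg_mul, Finset.sum_neg_distrib]
  have e₅ : ∑ i, c i * -s * g (y i) y₀ = -((∑ i, c i * g (y i) y₀) * s) := by
    rw [Finset.sum_mul, ← Finset.sum_neg_distrib]
    exact Finset.sum_congr rfl fun i _ => by ring
  rw [e₁, e₂, e₃, e₄, e₅]
  ring

/-- On a compact metric space there are finite continuous partitions of unity whose members are
supported in arbitrarily small balls. -/
theorem exists_finite_partition_of_unity {X : Type*} [MetricSpace X] [CompactSpace X] {δ : ℝ}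
    (hδ : 0 < δ) :
    ∃ (n : ℕ) (z : Fin n → X) (w : Fin n → C(X, ℝ)), (∀ i x, 0 ≤ w i x) ∧
      (∀ x, ∑ i, w i x = 1) ∧ ∀ i x, w i x ≠ 0 → dist x (z i) < δ := by
  obtain ⟨t, -, ht, hcov⟩ := (isCompact_univ (X := X)).finite_cover_balls hδ
  lift t to Finset X using ht
  let z : Fin t.card → X := fun i => t.equivFin.symm i
  let b : Fin t.card → X → ℝ := fun i x => max 0 (δ - dist x (z i))
  have hb0 : ∀ i x, 0 ≤ b i x := fun i x => le_max_left _ _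
  have hbc : ∀ i, Continuous (b i) := fun i => by fun_prop
  have hS : ∀ x, 0 < ∑ i, b i x := by
    intro x
    obtain ⟨y, hy, hxy⟩ : ∃ y ∈ t, dist x y < δ := by
      simpa using hcov (Set.mem_univ x)
    refine Finset.sum_pos' (fun i _ => hb0 i x) ⟨t.equivFin ⟨y, hy⟩, Finset.mem_univ _, ?_⟩
    simp [b, z, hxy]
  refine ⟨t.card, z, fun i => ⟨fun x => b i x / ∑ j, b j x, ?_⟩, ?_, ?_, ?_⟩
  · exact (hbc i).div (continuous_finsetSum _ fun j _ => hbc j) fun x => (hS x).ne'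
  · exact fun i x => div_nonneg (hb0 i x) (hS x).le
  · intro x
    simp only [ContinuousMap.coe_mk, ← Finset.sum_div]
    exact div_self (hS x).ne'
  · intro i x h
    by_contra hd
    exact h (by simp [b, not_lt.1 hd])

/-- A continuous symmetric positive semidefinite kernel on a compact metric space is a uniform
limit of kernels `∑ i, φ i x * φ i x'` with finitely many continuous features. -/
theorem exists_feature_map_approx {X : Type*} [MetricSpace X] [CompactSpace X] (G : C(X × X, ℝ))
    (hsymm : ∀ x x', G (x, x') = G (x', x))
    (hG : ∀ (n : ℕ) (c : Fin n → ℝ) (x : Fin n → X), 0 ≤ ∑ i, ∑ j, c i * c j * G (x i, x j))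
    {ε : ℝ} (hε : 0 < ε) :
    ∃ (n : ℕ) (φ : Fin n → C(X, ℝ)), ∀ x x', |∑ i, φ i x * φ i x' - G (x, x')| ≤ ε := by
  obtain ⟨δ, hδ, hGδ⟩ := Metric.uniformContinuous_iff.1
    (CompactSpace.uniformContinuous_of_continuous G.continuous) ε hε
  obtain ⟨n, z, w, hw0, hw1, hwz⟩ := exists_finite_partition_of_unity (X := X) hδ
  let P : Matrix (Fin n) (Fin n) ℝ := Matrix.of fun i j => G (z i, z j)
  have hP : P.PosSemidef := by
    refine .of_dotProduct_mulVec_nonneg ?_ fun c => ?_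
    · exact Matrix.IsHermitian.ext fun i j => hsymm _ _
    · have hc : star c ⬝ᵥ (P *ᵥ c) = ∑ i, ∑ j, c i * c j * G (z i, z j) := by
        simp only [dotProduct, Matrix.mulVec, P, Matrix.of_apply, Finset.mul_sum, star_trivial]
        exact Finset.sum_congr rfl fun i _ => Finset.sum_congr rfl fun j _ => by ring
      exact hc ▸ hG n c z
  obtain ⟨B, hB⟩ := hP.exists_eq_sum_mul
  have hPB : ∀ i j, G (z i, z j) = ∑ k, B k i * B k j := hB
  refine ⟨n, fun k => ∑ i, B k i • w i, fun x x' => ?_⟩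
  have e₁ : ∑ k, (∑ i, B k i • w i) x * (∑ i, B k i • w i) x' =
      ∑ i, ∑ j, w i x * w j x' * G (z i, z j) := by
    simp only [ContinuousMap.sum_apply, ContinuousMap.smul_apply, smul_eq_mul, Finset.sum_mul_sum, hPB]
    simp only [Finset.mul_sum]
    rw [Finset.sum_comm]
    refine Finset.sum_congr rfl fun i _ => ?_
    rw [Finset.sum_comm]
    exact Finset.sum_congr rfl fun j _ => Finset.sum_congr rfl fun k _ => by ring
  have hww : ∑ i, ∑ j, w i x * w j x' = 1 := by
    rw [← Finset.sum_mul_sum, hw1, hw1, one_mul]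
  have e₂ : ∀ a : ℝ, a = ∑ i, ∑ j, w i x * w j x' * a := fun a => by
    simp only [← Finset.sum_mul, hww, one_mul]
  -- Both sides become averages with weights `w i x * w j x'`; only nodes near `x` and `x'` carry
  -- weight, and there `G` varies by less than `ε`.
  rw [e₁, e₂ (G (x, x')), e₂ ε, ← Finset.sum_sub_distrib]
  refine (Finset.abs_sum_le_sum_abs _ _).trans (Finset.sum_le_sum fun i _ => ?_)
  rw [← Finset.sum_sub_distrib]
  refine (Finset.abs_sum_le_sum_abs _ _).trans (Finset.sum_le_sum fun j _ => ?_)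
  rw [← mul_sub, abs_mul, abs_of_nonneg (mul_nonneg (hw0 _ _) (hw0 _ _))]
  by_cases h : w i x = 0
  · simp [h]
  by_cases h' : w j x' = 0
  · simp [h']
  refine mul_le_mul_of_nonneg_left ?_ (mul_nonneg (hw0 _ _) (hw0 _ _))
  rw [← Real.dist_eq, dist_comm]
  exact (hGδ (a := (x, x')) (b := (z i, z j)) (max_lt (hwz i x h) (hwz j x' h'))).le

/-! ### Univariate approximation by sigmoids -/

/-- A step sum `∑ (U (i+1) - U i) s(l (t - (i+1)))` built from a sigmoidal `s` approximates any
sequence-interpolating function with small increments. -/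
theorem exists_sigmoid_step_sum_approx {s : ℝ → ℝ} (hs0 : ∀ t, 0 ≤ s t) (hs1 : ∀ t, s t ≤ 1)
    (hbot : Tendsto s atBot (𝓝 0)) (htop : Tendsto s atTop (𝓝 1)) (N : ℕ) (U : ℕ → ℝ) {δ : ℝ}
    (hδ : 0 < δ) (hU : ∀ i, i < N → |U (i + 1) - U i| ≤ δ) :
    ∃ l : ℝ, ∀ t : ℝ, 0 ≤ t → t ≤ N →
      |U 0 + ∑ i ∈ Finset.range N, (U (i + 1) - U i) * s (l * (t - (i + 1))) - U ⌊t⌋₊| ≤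
        2 * δ := by
  -- With `N * η ≤ 1`, the terms' tail errors total at most `δ`; the one jump near `t` costs at most
  -- another `δ`.
  obtain ⟨η, hη, hNη⟩ : ∃ η : ℝ, 0 < η ∧ N * η ≤ 1 :=
    ⟨1 / (N + 1), by positivity, by
      rw [mul_one_div, div_le_one (by positivity)]; linarith⟩
  obtain ⟨a, ha⟩ := eventually_atBot.1 (hbot.eventually (gt_mem_nhds hη))
  obtain ⟨b, hb⟩ := eventually_atTop.1 (htop.eventually (lt_mem_nhds (sub_lt_self 1 hη)))
  -- So steep that `s (l * u)` is within `η` of its limit once `|u| ≥ 1/2`.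
  let l : ℝ := 2 * (|a| + |b| + 1)
  have hl : 0 < l := by positivity
  have hla : ∀ u, u ≤ -(1 / 2) → l * u ≤ a := fun u hu => by
    have : l * u ≤ l * -(1 / 2) := mul_le_mul_of_nonneg_left hu hl.le
    have h2 : l * -(1 / 2) = -(|a| + |b| + 1) := by simp only [l]; ring
    linarith [neg_abs_le a, abs_nonneg b]
  have hlb : ∀ u, 1 / 2 ≤ u → b ≤ l * u := fun u hu => by
    have : l * (1 / 2) ≤ l * u := mul_le_mul_of_nonneg_left hu hl.le
    have h2 : l * (1 / 2) = |a| + |b| + 1 := by simp only [l]; ring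
    linarith [le_abs_self b, abs_nonneg a]
  refine ⟨l, fun t ht0 htN => ?_⟩
  let H : ℕ → ℝ := fun i => if i < ⌊t⌋₊ then 1 else 0
  have hfl : ⌊t⌋₊ ≤ N := Nat.floor_le_of_le htN
  have htel : U ⌊t⌋₊ = U 0 + ∑ i ∈ Finset.range N, (U (i + 1) - U i) * H i := by
    simp only [H, mul_ite, mul_one, mul_zero]
    rw [← Finset.sum_filter]
    have : (Finset.range N).filter (fun i => i < ⌊t⌋₊) = Finset.range ⌊t⌋₊ := by
      ext i; simp only [Finset.mem_filter, Finset.mem_range]; omega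
    rw [this, Finset.sum_range_sub]
    ring
  let Q : ℕ → Prop := fun i => |t - (i + 1)| < 1 / 2
  classical
  have hterm : ∀ i : ℕ, |s (l * (t - (i + 1))) - H i| ≤ η + if Q i then 1 else 0 := by
    intro i
    have hH : i < ⌊t⌋₊ ↔ (i : ℝ) + 1 ≤ t := by
      rw [← Nat.succ_le_iff, Nat.le_floor_iff ht0]; push_cast; rfl
    by_cases hQ : Q i
    · simp only [hQ, if_true, H]
      have := hs0 (l * (t - (i + 1)))
      have := hs1 (l * (t - (i + 1)))
      split_ifs <;> rw [abs_le] <;> constructor <;> linarith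
    · simp only [hQ, if_false, add_zero]
      rcases le_abs.1 (not_lt.1 hQ) with h | h
      · have h1 := hb _ (hlb _ h)
        have := hs1 (l * (t - (i + 1)))
        simp only [H, if_pos (hH.2 (by linarith))]
        rw [abs_le]; constructor <;> linarith
      · have h1 := ha _ (hla (t - (i + 1)) (by linarith))
        have := hs0 (l * (t - (i + 1)))
        simp only [H, if_neg (fun h' => absurd (hH.1 h') (by linarith))]
        rw [abs_le]; constructor <;> linarith
  -- The jumps are at integers, so at most one is closer than 1/2 to `t`.
  have hcard : ((Finset.range N).filter Q).card ≤ 1 := by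
    refine Finset.card_le_one.2 fun i hi j hj => ?_
    have hi' := abs_lt.1 (Finset.mem_filter.1 hi).2
    have hj' := abs_lt.1 (Finset.mem_filter.1 hj).2
    have h1 : (i : ℝ) < j + 1 := by linarith [hi'.1, hj'.2]
    have h2 : (j : ℝ) < i + 1 := by linarith [hi'.2, hj'.1]
    have h1' : i < j + 1 := by exact_mod_cast h1
    have h2' : j < i + 1 := by exact_mod_cast h2
    omega
  rw [htel, add_sub_add_left_eq_sub, ← Finset.sum_sub_distrib]
  calc _ ≤ ∑ i ∈ Finset.range N, δ * (η + if Q i then 1 else 0) := by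
        refine (Finset.abs_sum_le_sum_abs _ _).trans (Finset.sum_le_sum fun i hi => ?_)
        rw [← mul_sub, abs_mul]
        exact mul_le_mul (hU i (Finset.mem_range.1 hi)) (hterm i) (abs_nonneg _) hδ.le
    _ = δ * (N * η + ((Finset.range N).filter Q).card) := by
        rw [← Finset.mul_sum, Finset.sum_add_distrib, Finset.sum_boole]
        simp
    _ ≤ δ * (1 + 1) := by
        have : (((Finset.range N).filter Q).card : ℝ) ≤ 1 := by exact_mod_cast hcard
        gcongr
    _ = 2 * δ := by ring

/-- Univariate universal approximation: on a bounded interval, a continuous function is uniformly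
approximated by a constant plus a combination of affine shifts of a sigmoidal function. -/
theorem exists_sigmoid_approx {s : ℝ → ℝ} (hs0 : ∀ t, 0 ≤ s t) (hs1 : ∀ t, s t ≤ 1)
    (hbot : Tendsto s atBot (𝓝 0)) (htop : Tendsto s atTop (𝓝 1)) {u : ℝ → ℝ}
    (hu : Continuous u) {R : ℝ} (hR : 0 < R) {ε : ℝ} (hε : 0 < ε) :
    ∃ (N : ℕ) (k : ℝ) (d a b : ℕ → ℝ), ∀ t, |t| ≤ R →
      |k + ∑ i ∈ Finset.range N, d i * s (a i * t + b i) - u t| ≤ ε := by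
  obtain ⟨ρ, hρ, hu'⟩ := Metric.uniformContinuousOn_iff.1
    ((isCompact_Icc (a := -R) (b := R)).uniformContinuousOn_of_continuous hu.continuousOn)
    (ε / 3) (by positivity)
  obtain ⟨N, hN⟩ := exists_nat_gt (2 * R / ρ)
  have hN0 : (0 : ℝ) < N := lt_trans (by positivity) hN
  let h : ℝ := 2 * R / N
  have hh : 0 < h := by positivity
  have hhρ : h < ρ := by
    rw [div_lt_iff₀ hρ] at hN
    rw [div_lt_iff₀ hN0]; linarith
  have hhN : h * N = 2 * R := div_mul_cancel₀ _ hN0.ne'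
  have hmem : ∀ z : ℝ, 0 ≤ z → z ≤ N → -R + h * z ∈ Set.Icc (-R) R := fun z h0 h1 =>
    ⟨by nlinarith, by nlinarith⟩
  let U : ℕ → ℝ := fun i => u (-R + h * i)
  obtain ⟨l, hl⟩ := exists_sigmoid_step_sum_approx hs0 hs1 hbot htop N U (δ := ε / 3)
    (by positivity) fun i hi => by
      rw [← Real.dist_eq]
      have hi' : (i : ℝ) + 1 ≤ N := by exact_mod_cast hi
      refine (hu' _ (hmem _ (by positivity) (by exact_mod_cast hi)) _
        (hmem _ (by positivity) (by linarith)) ?_).le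
      rw [Real.dist_eq, show -R + h * ((i + 1 : ℕ) : ℝ) - (-R + h * i) = h by push_cast; ring,
        abs_of_pos hh]
      exact hhρ
  refine ⟨N, U 0, fun i => U (i + 1) - U i, fun _ => l / h, fun i => l * (R / h - (i + 1)),
    fun t ht => ?_⟩
  obtain ⟨ht1, ht2⟩ := abs_le.1 ht
  have hz0 : 0 ≤ (t + R) / h := div_nonneg (by linarith) hh.le
  have hzN : (t + R) / h ≤ N := by rw [div_le_iff₀ hh]; linarith
  have hzt : h * ((t + R) / h) = t + R := mul_div_cancel₀ _ hh.ne'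
  have h1 := hl _ hz0 hzN
  have h2 : |U ⌊(t + R) / h⌋₊ - u t| ≤ ε / 3 := by
    rw [← Real.dist_eq]
    have hf1 := Nat.floor_le hz0
    have hf2 := Nat.lt_floor_add_one ((t + R) / h)
    refine (hu' _ (hmem _ (by positivity) (hf1.trans hzN)) _ ⟨ht1, ht2⟩ ?_).le
    rw [Real.dist_eq, abs_lt]
    constructor <;> nlinarith
  have h3 : ∀ i : ℕ, l / h * t + l * (R / h - (i + 1)) = l * ((t + R) / h - (i + 1)) := fun i => by
    ring
  simp only [h3]
  refine (abs_sub_le _ (U ⌊(t + R) / h⌋₊) _).trans ?_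
  linarith

/-! ### Density of neurons on the cube -/

instance compactSpace_cube (p : ℕ) (M : ℝ) : CompactSpace (cube p M) := by
  refine isCompact_iff_compactSpace.1 ?_
  have h := (isCompact_univ_pi fun _ : Fin p => isCompact_Icc (a := -M) (b := M)).image
    (PiLp.continuous_toLp 2 fun _ : Fin p => ℝ)
  convert h using 1
  ext x
  constructor
  · exact fun hx => ⟨x.ofLp, fun i _ => hx i, rfl⟩
  · rintro ⟨y, hy, rfl⟩ i
    exact hy i trivial

/-- The affine form `x ↦ ⟨w, x⟩ + b` on the cube. -/
def cubeAffine (p : ℕ) (M : ℝ) (w : Fin p → ℝ) (b : ℝ) : C(cube p M, ℝ) where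
  toFun x := (w ⬝ᵥ x.1.ofLp) + b
  continuous_toFun := by
    unfold dotProduct
    fun_prop

/-- The span of the functions `t ↦ σ (a t + b)`. -/
def affineSpan₁ (σ : C(ℝ, ℝ)) : Submodule ℝ C(ℝ, ℝ) :=
  Submodule.span ℝ (Set.range fun q : ℝ × ℝ => σ.comp ⟨fun t => q.1 * t + q.2, by fun_prop⟩)

/-- The span of the functions `x ↦ σ (⟨w, x⟩ + b)` on the cube. -/
def neuronSpan (p : ℕ) (M : ℝ) (σ : C(ℝ, ℝ)) : Submodule ℝ C(cube p M, ℝ) :=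
  Submodule.span ℝ (Set.range fun q : (Fin p → ℝ) × ℝ => σ.comp (cubeAffine p M q.1 q.2))

theorem comp_cubeAffine_mem_neuronSpan {p : ℕ} {M : ℝ} {σ v : C(ℝ, ℝ)} (hv : v ∈ affineSpan₁ σ)
    (w : Fin p → ℝ) (b : ℝ) : v.comp (cubeAffine p M w b) ∈ neuronSpan p M σ := by
  have h : affineSpan₁ σ ≤ (neuronSpan p M σ).comap
      (ContinuousMap.compRightAlgHom ℝ ℝ (cubeAffine p M w b)).toLinearMap := by
    refine Submodule.span_le.2 ?_
    rintro _ ⟨⟨a, d⟩, rfl⟩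
    refine Submodule.subset_span ⟨(a • w, a * b + d), ?_⟩
    ext x
    simp [cubeAffine, mul_add, add_assoc]
  exact h hv

theorem IsActivation.continuous {σ : ℝ → ℝ} (hσ : IsActivation σ) : Continuous σ := by
  rcases hσ with rfl | h
  · exact continuous_const.max continuous_id
  · exact h.2.1

theorem IsActivation.one_mem_affineSpan₁ {σ : C(ℝ, ℝ)} (hσ : IsActivation σ) :
    1 ∈ affineSpan₁ σ := by
  obtain ⟨b, hb⟩ : ∃ b, σ b ≠ 0 := by
    rcases hσ with h | h
    · exact ⟨1, by simp [h, relu]⟩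
    · by_contra! h0
      exact h.1 ⟨0, h0⟩
  -- Slope zero turns the activation into the nonzero constant `σ b`.
  have h := (affineSpan₁ σ).smul_mem (σ b)⁻¹ (Submodule.subset_span ⟨(0, b), rfl⟩)
  convert h using 1
  ext t
  simp [hb]

/-- Affine reparametrizations of an activation function generate a sigmoidal function. -/
theorem IsActivation.exists_sigmoidal {σ : C(ℝ, ℝ)} (hσ : IsActivation σ) :
    ∃ s ∈ affineSpan₁ σ, (∀ t, 0 ≤ s t) ∧ (∀ t, s t ≤ 1) ∧
      Tendsto s atBot (𝓝 0) ∧ Tendsto s atTop (𝓝 1) := by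
  rcases id hσ with h | ⟨hc, -, ⟨B, hB⟩, hm⟩
  · refine ⟨σ.comp ⟨fun t => 1 * t + 1, by fun_prop⟩ - σ.comp ⟨fun t => 1 * t + 0, by fun_prop⟩,
      sub_mem (Submodule.subset_span ⟨(1, 1), rfl⟩) (Submodule.subset_span ⟨(1, 0), rfl⟩),
      fun t => ?_, fun t => ?_, ?_, ?_⟩
    · simp only [ContinuousMap.sub_apply, ContinuousMap.comp_apply, ContinuousMap.coe_mk, h, relu]
      exact sub_nonneg.2 (max_le_max le_rfl (by linarith))
    · simp only [ContinuousMap.sub_apply, ContinuousMap.comp_apply, ContinuousMap.coe_mk, h, relu]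
      rcases max_cases 0 (1 * t + 1) with h1 | h1 <;> rcases max_cases 0 (1 * t + 0) with h2 | h2 <;>
        linarith
    · refine tendsto_const_nhds.congr' ?_
      filter_upwards [eventually_le_atBot (-1 : ℝ)] with t ht
      simp only [ContinuousMap.sub_apply, ContinuousMap.comp_apply, ContinuousMap.coe_mk, h, relu]
      rw [max_eq_left (by linarith), max_eq_left (by linarith), sub_zero]
    · refine tendsto_const_nhds.congr' ?_
      filter_upwards [eventually_ge_atTop (0 : ℝ)] with t ht
      simp only [ContinuousMap.sub_apply, ContinuousMap.comp_apply, ContinuousMap.coe_mk, h, relu]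
      rw [max_eq_right (by linarith), max_eq_right (by linarith)]
      ring
  · have hba : BddAbove (Set.range σ) := ⟨B, by rintro _ ⟨t, rfl⟩; exact (abs_le.1 (hB t)).2⟩
    have hbb : BddBelow (Set.range σ) := ⟨-B, by rintro _ ⟨t, rfl⟩; exact (abs_le.1 (hB t)).1⟩
    obtain ⟨u, hu⟩ : ∃ u, u = ⨆ t, σ t := ⟨_, rfl⟩
    obtain ⟨l, hl⟩ : ∃ l, l = ⨅ t, σ t := ⟨_, rfl⟩
    have htop : Tendsto σ atTop (𝓝 u) := hu ▸ tendsto_atTop_ciSup hm hba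
    have hbot : Tendsto σ atBot (𝓝 l) := hl ▸ tendsto_atBot_ciInf hm hbb
    have hle : ∀ t, σ t ≤ u := fun t => hu ▸ le_ciSup hba t
    have hge : ∀ t, l ≤ σ t := fun t => hl ▸ ciInf_le hbb t
    have hlu : 0 < u - l := by
      by_contra hn
      exact hc ⟨l, fun t => le_antisymm ((hle t).trans (by linarith)) (hge t)⟩
    refine ⟨(u - l)⁻¹ • (σ - l • 1), Submodule.smul_mem _ _ (sub_mem ?_
      (Submodule.smul_mem _ _ hσ.one_mem_affineSpan₁)), fun t => ?_, fun t => ?_, ?_, ?_⟩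
    · refine Submodule.subset_span ⟨(1, 0), ?_⟩
      ext t
      simp
    · simpa using mul_nonneg (inv_nonneg.2 hlu.le) (sub_nonneg.2 (hge t))
    · have : (u - l)⁻¹ * (σ t - l) ≤ 1 := by
        rw [inv_mul_le_one₀ hlu]
        linarith [hle t]
      simpa using this
    · have := (hbot.sub_const l).const_mul (u - l)⁻¹
      rw [sub_self, mul_zero] at this
      refine this.congr fun t => ?_
      simp
    · have := (htop.sub_const l).const_mul (u - l)⁻¹
      rw [inv_mul_cancel₀ hlu.ne'] at this
      refine this.congr fun t => ?_
      simp

/-- The affine form is bounded on the compact cube, so uniform approximation of `u` on one interval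
suffices. -/
theorem IsActivation.ridge_mem_closure {p : ℕ} {M : ℝ} {σ : C(ℝ, ℝ)} (hσ : IsActivation σ)
    (u : C(ℝ, ℝ)) (w : Fin p → ℝ) :
    u.comp (cubeAffine p M w 0) ∈ (neuronSpan p M σ).topologicalClosure := by
  obtain ⟨s, hs, hs0, hs1, hbot, htop⟩ := hσ.exists_sigmoidal
  refine Metric.mem_closure_iff.2 fun ε hε => ?_
  obtain ⟨N, k, d, a, b, h⟩ := exists_sigmoid_approx hs0 hs1 hbot htop u.continuous
    (R := ‖cubeAffine p M w 0‖ + 1) (by positivity) (half_pos hε)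
  refine ⟨k • (1 : C(ℝ, ℝ)).comp (cubeAffine p M w 0) +
    ∑ i ∈ Finset.range N, d i • s.comp (cubeAffine p M (a i • w) (b i)), ?_, ?_⟩
  · exact add_mem (Submodule.smul_mem _ _
      (comp_cubeAffine_mem_neuronSpan hσ.one_mem_affineSpan₁ _ _))
      (sum_mem fun i _ => Submodule.smul_mem _ _ (comp_cubeAffine_mem_neuronSpan hs _ _))
  · rw [dist_comm]
    refine lt_of_le_of_lt ((ContinuousMap.dist_le (half_pos hε).le).2 fun x => ?_) (half_lt_self hε)
    rw [Real.dist_eq]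
    have hx := h (cubeAffine p M w 0 x)
      (((cubeAffine p M w 0).norm_coe_le_norm x).trans (by linarith))
    simpa [cubeAffine, ContinuousMap.sum_apply] using hx

/-- Universal approximation: the neurons of an activation function span a dense subspace of the
continuous functions on the cube. -/
theorem IsActivation.dense_neuronSpan {p : ℕ} {M : ℝ} {σ : C(ℝ, ℝ)} (hσ : IsActivation σ) :
    Dense (neuronSpan p M σ : Set C(cube p M, ℝ)) := by
  -- Exponentials of linear forms are closed under products, so their span is already an algebra and
  -- Stone–Weierstrass applies to it.
  let e : (Fin p → ℝ) → C(cube p M, ℝ) := fun w =>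
    (⟨Real.exp, Real.continuous_exp⟩ : C(ℝ, ℝ)).comp (cubeAffine p M w 0)
  let T : Submonoid C(cube p M, ℝ) :=
    { carrier := Set.range e
      one_mem' := ⟨0, by ext x; simp [e, cubeAffine]⟩
      mul_mem' := by
        rintro _ _ ⟨w, rfl⟩ ⟨w', rfl⟩
        exact ⟨w + w', by ext x; simp [e, cubeAffine, Real.exp_add]⟩ }
  have hle : Subalgebra.toSubmodule (Algebra.adjoin ℝ (T : Set C(cube p M, ℝ))) ≤
      (neuronSpan p M σ).topologicalClosure := by
    rw [Algebra.adjoin_eq_span, Submonoid.closure_eq]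
    refine Submodule.span_le.2 ?_
    rintro _ ⟨w, rfl⟩
    exact hσ.ridge_mem_closure _ w
  have hsep : (Algebra.adjoin ℝ (T : Set C(cube p M, ℝ))).SeparatesPoints := by
    intro x y hxy
    obtain ⟨j, hj⟩ : ∃ j, x.1 j ≠ y.1 j := by
      by_contra! h
      exact hxy (Subtype.ext (PiLp.ext h))
    refine ⟨_, ⟨e (Pi.single j 1), Algebra.subset_adjoin ⟨_, rfl⟩, rfl⟩, ?_⟩
    simpa [e, cubeAffine] using hj
  have htop := ContinuousMap.subalgebra_topologicalClosure_eq_top_of_separatesPoints _ hsep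
  intro F
  have hF : F ∈ (Algebra.adjoin ℝ (T : Set C(cube p M, ℝ))).topologicalClosure := by
    rw [htop]; trivial
  exact closure_minimal hle (Submodule.isClosed_topologicalClosure _) hF

/-! ### From the neuron span to networks -/

/-- Finitely many functions in the neuron span are the outputs of a single network of any
sufficiently large width. -/
theorem exists_oneHiddenNN_eq {p K : ℕ} {M : ℝ} {σ : C(ℝ, ℝ)} (ψ : Fin K → C(cube p M, ℝ))
    (hψ : ∀ i, ψ i ∈ neuronSpan p M σ) :
    ∃ m₀ : ℕ, ∀ m, m₀ ≤ m → ∃ (A : Matrix (Fin K) (Fin m) ℝ) (B : Matrix (Fin m) (Fin p) ℝ)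
      (c : Fin m → ℝ), ∀ (x : cube p M) (i : Fin K), oneHiddenNN σ A B c x i = ψ i x := by
  classical
  choose a ha using fun i => Finsupp.mem_span_range_iff_exists_finsupp.1 (hψ i)
  let T : Finset ((Fin p → ℝ) × ℝ) := Finset.univ.biUnion fun i => (a i).support
  refine ⟨T.card, fun m hm => ?_⟩
  let ι : T → Fin m := fun q => Fin.castLE hm (T.equivFin q)
  have hι : Function.Injective ι := (Fin.castLE_injective hm).comp T.equivFin.injective
  -- Surplus units get the dummy parameter 0; their columns in the output matrix vanish.
  let q : Fin m → (Fin p → ℝ) × ℝ := fun j => if h : ∃ t, ι t = j then h.choose.1 else 0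
  have hq : ∀ t, q (ι t) = t.1 := fun t => by
    have h : ∃ t', ι t' = ι t := ⟨t, rfl⟩
    simp only [q, dif_pos h, hι h.choose_spec]
  refine ⟨Matrix.of fun i j => if ∃ t, ι t = j then a i (q j) else 0,
    Matrix.of fun j => (q j).1, fun j => (q j).2, fun x i => ?_⟩
  have e₁ : oneHiddenNN σ (Matrix.of fun i j => if ∃ t, ι t = j then a i (q j) else 0)
      (Matrix.of fun j => (q j).1) (fun j => (q j).2) x i =
      ∑ j, (if ∃ t, ι t = j then a i (q j) else 0) * σ (cubeAffine p M (q j).1 (q j).2 x) := rfl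
  have e₂ : ψ i x = ∑ t ∈ T, a i t * σ (cubeAffine p M t.1 t.2 x) := by
    have hsub : (a i).support ⊆ T :=
      Finset.subset_biUnion_of_mem (fun i => (a i).support) (Finset.mem_univ i)
    rw [← ha i, Finsupp.sum_of_support_subset _ hsub _ fun t _ => by simp]
    simp [ContinuousMap.sum_apply]
  rw [e₁, e₂, ← Finset.sum_coe_sort T]
  symm
  refine Finset.sum_of_injOn ι hι.injOn (fun _ _ => Finset.mem_univ _) (fun j _ hj => ?_)
    fun t _ => ?_
  · rw [if_neg, zero_mul]
    rintro ⟨t, rfl⟩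
    exact hj ⟨t, Finset.mem_coe.2 (Finset.mem_univ _), rfl⟩
  · rw [if_pos ⟨t, rfl⟩, hq]

/-- Networks of all sufficiently large widths approximate the Gram kernel of a continuous feature
map. -/
theorem exists_oneHiddenNN_inner_approx {p K : ℕ} {M : ℝ} {σ : C(ℝ, ℝ)} (hσ : IsActivation σ)
    (φ : Fin K → C(cube p M, ℝ)) {ε : ℝ} (hε : 0 < ε) :
    ∃ m₀ : ℕ, ∀ m, m₀ ≤ m → ∃ (A : Matrix (Fin K) (Fin m) ℝ) (B : Matrix (Fin m) (Fin p) ℝ)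
      (c : Fin m → ℝ), ∀ x x' : cube p M,
        |inner ℝ (oneHiddenNN σ A B c x) (oneHiddenNN σ A B c x') - ∑ i, φ i x * φ i x'| < ε := by
  let Φ : (Fin K → C(cube p M, ℝ)) → C(cube p M × cube p M, ℝ) := fun ψ =>
    ∑ i, (ψ i).comp ContinuousMap.fst * (ψ i).comp ContinuousMap.snd
  have hΦ : Continuous Φ := continuous_finsetSum _ fun i _ =>
    ((ContinuousMap.continuous_precomp _).comp (continuous_apply i)).mul
      ((ContinuousMap.continuous_precomp _).comp (continuous_apply i))
  -- The Gram kernel depends continuously on the features, so density lets them be replaced by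
  -- functions in the span.
  obtain ⟨ψ, hψ, hΦψ⟩ := (dense_pi Set.univ fun (_ : Fin K) _ =>
    hσ.dense_neuronSpan (p := p) (M := M)).exists_mem_open
      (Metric.isOpen_ball.preimage hΦ) ⟨φ, Metric.mem_ball_self (x := Φ φ) hε⟩
  obtain ⟨m₀, hm₀⟩ := exists_oneHiddenNN_eq ψ fun i => hψ i trivial
  refine ⟨m₀, fun m hm => ?_⟩
  obtain ⟨A, B, c, h⟩ := hm₀ m hm
  refine ⟨A, B, c, fun x x' => ?_⟩
  have e₁ : inner ℝ (oneHiddenNN σ A B c x) (oneHiddenNN σ A B c x') = Φ ψ (x, x') := by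
    simp [PiLp.inner_apply, h, Φ, ContinuousMap.sum_apply, mul_comm]
  have e₂ : ∑ i, φ i x * φ i x' = Φ φ (x, x') := by
    simp [Φ, ContinuousMap.sum_apply]
  rw [e₁, e₂, ← Real.dist_eq]
  exact (ContinuousMap.dist_apply_le_dist _).trans_lt (Metric.mem_ball.1 hΦψ)

/-! ### Shifted features and the conclusion -/

theorem mainTheorem2 {p Kstar : ℕ} {M : ℝ} (hM : 0 < M)
    (Y : Set (EuclideanSpace ℝ (Fin Kstar))) (hY : IsCompact Y)
    (fstar : cube p M → Y) (hf : Continuous fstar)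
    (g : Y → Y → ℝ) (hg : IsCPDKernel g)
    (σ : ℝ → ℝ) (hσ : IsActivation σ) :
    ∃ (C r₀ : ℝ) (γ : ℝ → ℝ), 0 < C ∧ 0 < r₀ ∧
      (∀ r, r₀ ≤ r → |γ r| ≤ C * r ^ 2) ∧
      ∀ ε > (0 : ℝ), ∀ r, r₀ ≤ r →
        ∃ K₀ : ℕ, ∀ K, K₀ ≤ K → ∃ m₀ : ℕ, ∀ m, m₀ ≤ m →
          ∃ (A : Matrix (Fin K) (Fin m) ℝ) (B : Matrix (Fin m) (Fin p) ℝ) (c : Fin m → ℝ),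
            ∀ x x' : cube p M,
              |g (fstar x) (fstar x') -
                  (inner ℝ (oneHiddenNN σ A B c x) (oneHiddenNN σ A B c x') - γ r)|
                < ε + C / r ^ 2 := by
  obtain ⟨σ, rfl⟩ : ∃ s : C(ℝ, ℝ), ⇑s = σ := ⟨⟨σ, hσ.continuous⟩, rfl⟩
  let y₀ : Y := fstar ⟨0, fun i => ⟨by simpa using hM.le, by simpa using hM.le⟩⟩
  have hgc := hg.continuous
  -- Halving `g y₀ y₀` shares the constant equally between `h x` and `h x'`.
  let h : C(cube p M, ℝ) := ⟨fun x => g (fstar x) y₀ - g y₀ y₀ / 2, by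
    exact (hgc.comp (hf.prodMk continuous_const)).sub continuous_const⟩
  let G : C(cube p M × cube p M, ℝ) := ⟨fun q => g (fstar q.1) (fstar q.2) - g (fstar q.1) y₀ -
    g y₀ (fstar q.2) + g y₀ y₀, by
      exact (((hgc.comp ((hf.comp continuous_fst).prodMk (hf.comp continuous_snd))).sub
        (hgc.comp ((hf.comp continuous_fst).prodMk continuous_const))).sub
        (hgc.comp (continuous_const.prodMk (hf.comp continuous_snd)))).add continuous_const⟩
  have hgG : ∀ x x', g (fstar x) (fstar x') = G (x, x') + h x + h x' := fun x x' => by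
    simp only [G, h, ContinuousMap.coe_mk, hg.symm y₀ (fstar x')]
    ring
  have hGs : ∀ x x', G (x, x') = G (x', x) := fun x x' => by
    have := hgG x x'
    rw [hg.symm, hgG] at this
    linarith
  -- The 1 serves the bound on γ, and `‖h‖ ^ 2` the remainder hh'/r².
  refine ⟨max 1 (‖h‖ ^ 2), 1, fun r => r ^ 2, by positivity, one_pos, fun r hr => ?_,
    fun ε hε r hr => ?_⟩
  · rw [abs_of_nonneg (sq_nonneg r)]
    exact le_mul_of_one_le_left (sq_nonneg r) (le_max_left _ _)
  have hr0 : 0 < r := one_pos.trans_le hr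
  obtain ⟨n, φ, hφ⟩ := exists_feature_map_approx G hGs
    (fun n c x => hg.pinned_nonneg y₀ c (fstar ∘ x)) (half_pos hε)
  refine ⟨n + 1, fun K hK => ?_⟩
  obtain ⟨k, rfl⟩ := Nat.exists_eq_add_of_le hK
  -- Zero features pad the map to any output dimension above `n`.
  let φ' : Fin (n + 1 + k) → C(cube p M, ℝ) :=
    Fin.append (Fin.cons (ContinuousMap.const _ r + r⁻¹ • h) φ) 0
  have hφ' : ∀ x x', ∑ i, φ' i x * φ' i x' =
      (r + r⁻¹ * h x) * (r + r⁻¹ * h x') + ∑ i, φ i x * φ i x' := fun x x' => by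
    simp [φ', Fin.sum_univ_add, Fin.sum_univ_succ]
  obtain ⟨m₀, hm₀⟩ := exists_oneHiddenNN_inner_approx hσ φ' (half_pos hε)
  refine ⟨m₀, fun m hm => ?_⟩
  obtain ⟨A, B, c, hABc⟩ := hm₀ m hm
  refine ⟨A, B, c, fun x x' => ?_⟩
  have h₁ := abs_lt.1 (hABc x x')
  have h₂ := abs_le.1 (hφ x x')
  have h₃ : |h x * h x' / r ^ 2| ≤ max 1 (‖h‖ ^ 2) / r ^ 2 := by
    rw [abs_div, abs_of_pos (pow_pos hr0 2), abs_mul]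
    gcongr
    refine le_trans ?_ (le_max_right _ _)
    rw [sq]
    exact mul_le_mul (h.norm_coe_le_norm x) (h.norm_coe_le_norm x') (abs_nonneg _) (norm_nonneg _)
  have h₃' := abs_le.1 h₃
  have h₄ : (r + r⁻¹ * h x) * (r + r⁻¹ * h x') = r ^ 2 + h x + h x' + h x * h x' / r ^ 2 := by
    field_simp
    ring
  rw [hφ', h₄] at h₁
  rw [hgG, abs_lt]
  constructor <;> linarith [h₁.1, h₁.2, h₂.1, h₂.2, h₃'.1, h₃'.2]
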